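/- Throughout, $[0,1]$ is the standard MV-algebra, with $x\oplus y=\min\{x+y,1\}$, $\neg x=1-x$ and neutral element $0$. For a set $I$, let $\mathscr F(I)$ be the free MV-algebra over $I$, and for $p\in[0,1]^I$ let $\bar p\colon\mathscr F(I)\to[0,1]$ be the unique MV-homomorphism extending $p\colon I\to[0,1]$. For $I'\subseteq I$, $\pi^I_{I'}\colon[0,1]^I\to[0,1]^{I'}$ is the projection. For a finite set $I'$, a map $f\colon[0,1]^{I'}\to[0,1]$ is *piecewise linear with integer coefficients* if it is continuous and there are finitely many affine functions $f_1,\dots,f_k\colon[0,1]^{I'}\to\mathbb R$, each of the form $f_i(x)=b_i+\sum_{m\in I'}a_{i,m}x_m$ with $a_{i,m},b_i\in\mathbb Z$, such that for every $x\in[0,1]^{I'}$ there is an $i$ with $f(x)=f_i(x)$. For an arbitrary set $I$, a map $f\colon[0,1]^I\to[0,1]$ is *piecewise linear with integer coefficients* if $f=f'\circ\pi^I_{I'}$ for some finite $I'\subseteq I$ and some $f'\colon[0,1]^{I'}\to[0,1]$ that is piecewise linear with integer coefficients. Let $I,J$ be arbitrary sets, $P\subseteq[0,1]^I$ and $Q\subseteq[0,1]^J$.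 A map $\eta\colon P\to Q$ is *definable* if there are elements $t_j\in\mathscr F(I)$ $(j\in J)$ with $\eta(p)(j)=\bar p(t_j)$ for all $p\in P$ and $j\in J$. It is a *$\mathbb Z$-map* if for every $j\in J$ there is a map $\xi_j\colon[0,1]^I\to[0,1]$, piecewise linear with integer coefficients, such that $\eta(p)(j)=\xi_j(p)$ for all $p\in P$. **Theorem.** Let $I,J$ be arbitrary sets, $P\subseteq[0,1]^I$ and $Q\subseteq[0,1]^J$. For any map $\eta\colon P\to Q$ the following are equivalent: (i) $\eta$ is definable; (ii) $\eta$ is a $\mathbb Z$-map; (iii) for each finite subset $J'\subseteq J$ there exist a finite subset $I'\subseteq I$ and a $\mathbb Z$-map $\xi\colon[0,1]^{I'}\to[0,1]^{J'}$ such that $\pi^J_{J'}\circ\eta=\xi\circ\pi^I_{I'}$ on $P$. -/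

import Mathlib

universe u v

/-- An MV-algebra: an abelian monoid `(A, ⊕, 0)` with an operation `¬` such that `¬¬x = x`,
`x ⊕ ¬0 = ¬0` and `x ⊕ ¬(x ⊕ ¬y) = y ⊕ ¬(y ⊕ ¬x)`. -/
class MVAlgebra (A : Type u) where
  oplus : A → A → A
  zero : A
  neg : A → A
  oplus_assoc : ∀ x y z, oplus (oplus x y) z = oplus x (oplus y z)
  oplus_comm : ∀ x y, oplus x y = oplus y x
  oplus_zero : ∀ x, oplus x zero = x
  neg_neg : ∀ x, neg (neg x) = x
  oplus_neg_zero : ∀ x, oplus x (neg zero) = neg zero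
  oplus_neg_oplus : ∀ x y, oplus x (neg (oplus x (neg y))) = oplus y (neg (oplus y (neg x)))

/-- Homomorphisms of MV-algebras. -/
structure MVHom (A : Type u) (B : Type v) [MVAlgebra A] [MVAlgebra B] where
  toFun : A → B
  map_oplus : ∀ x y, toFun (MVAlgebra.oplus x y) = MVAlgebra.oplus (toFun x) (toFun y)
  map_zero : toFun MVAlgebra.zero = MVAlgebra.zero
  map_neg : ∀ x, toFun (MVAlgebra.neg x) = MVAlgebra.neg (toFun x)

namespace MVAlgebra

/-- Terms in the language of MV-algebras, with variables in `X`. -/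
inductive PreTerm (X : Type u) : Type u
  | var : X → PreTerm X
  | zero : PreTerm X
  | neg : PreTerm X → PreTerm X
  | oplus : PreTerm X → PreTerm X → PreTerm X

/-- The congruence on terms generated by the MV-algebra identities. -/
inductive PreTerm.Rel {X : Type u} : PreTerm X → PreTerm X → Prop
  | refl (s) : PreTerm.Rel s s
  | symm {s t} : PreTerm.Rel s t → PreTerm.Rel t s
  | trans {s t r} : PreTerm.Rel s t → PreTerm.Rel t r → PreTerm.Rel s r
  | neg_congr {s t} : PreTerm.Rel s t → PreTerm.Rel (.neg s) (.neg t)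
  | oplus_congr {s t s₁ t₁} : PreTerm.Rel s t → PreTerm.Rel s₁ t₁ →
      PreTerm.Rel (.oplus s s₁) (.oplus t t₁)
  | oplus_assoc (x y z) : PreTerm.Rel (.oplus (.oplus x y) z) (.oplus x (.oplus y z))
  | oplus_comm (x y) : PreTerm.Rel (.oplus x y) (.oplus y x)
  | oplus_zero (x) : PreTerm.Rel (.oplus x .zero) x
  | neg_neg (x) : PreTerm.Rel (.neg (.neg x)) x
  | oplus_neg_zero (x) : PreTerm.Rel (.oplus x (.neg .zero)) (.neg .zero)
  | oplus_neg_oplus (x y) : PreTerm.Rel (.oplus x (.neg (.oplus x (.neg y))))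
      (.oplus y (.neg (.oplus y (.neg x))))

/-- The setoid of the congruence `PreTerm.Rel`. -/
def PreTerm.setoid (X : Type u) : Setoid (PreTerm X) where
  r := PreTerm.Rel
  iseqv := ⟨PreTerm.Rel.refl, PreTerm.Rel.symm, PreTerm.Rel.trans⟩

/-- Evaluation of a term in an MV-algebra under a valuation of the variables. -/
def PreTerm.eval {X : Type u} {B : Type v} [MVAlgebra B] (p : X → B) : PreTerm X → B
  | .var x => p x
  | .zero => MVAlgebra.zero
  | .neg s => MVAlgebra.neg (s.eval p)
  | .oplus s t => MVAlgebra.oplus (s.eval p) (t.eval p)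

theorem PreTerm.Rel.eval_eq {X : Type u} {B : Type v} [MVAlgebra B] (p : X → B)
    {s t : PreTerm X} (h : PreTerm.Rel s t) : s.eval p = t.eval p := by
  induction h with
  | refl s => rfl
  | symm _ ih => exact ih.symm
  | trans _ _ ih₁ ih₂ => exact ih₁.trans ih₂
  | neg_congr _ ih => simp only [PreTerm.eval, ih]
  | oplus_congr _ _ ih₁ ih₂ => simp only [PreTerm.eval, ih₁, ih₂]
  | oplus_assoc x y z => exact MVAlgebra.oplus_assoc _ _ _
  | oplus_comm x y => exact MVAlgebra.oplus_comm _ _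
  | oplus_zero x => exact MVAlgebra.oplus_zero _
  | neg_neg x => exact MVAlgebra.neg_neg _
  | oplus_neg_zero x => exact MVAlgebra.oplus_neg_zero _
  | oplus_neg_oplus x y => exact MVAlgebra.oplus_neg_oplus _ _

end MVAlgebra

open MVAlgebra in
/-- The free MV-algebra over `X`: terms modulo the congruence generated by the identities of
MV-algebras. Its universal property is `FreeMV.existsUnique_hom`. -/
def FreeMV (X : Type u) : Type u := Quotient (PreTerm.setoid X)

namespace FreeMV

open MVAlgebra

instance (X : Type u) : MVAlgebra (FreeMV X) where
  oplus := Quotient.map₂ PreTerm.oplus (fun _ _ h _ _ h₁ => PreTerm.Rel.oplus_congr h h₁)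
  zero := Quotient.mk _ PreTerm.zero
  neg := Quotient.map PreTerm.neg (fun _ _ h => PreTerm.Rel.neg_congr h)
  oplus_assoc := by
    rintro ⟨x⟩ ⟨y⟩ ⟨z⟩; exact Quotient.sound (PreTerm.Rel.oplus_assoc x y z)
  oplus_comm := by
    rintro ⟨x⟩ ⟨y⟩; exact Quotient.sound (PreTerm.Rel.oplus_comm x y)
  oplus_zero := by
    rintro ⟨x⟩; exact Quotient.sound (PreTerm.Rel.oplus_zero x)
  neg_neg := by
    rintro ⟨x⟩; exact Quotient.sound (PreTerm.Rel.neg_neg x)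
  oplus_neg_zero := by
    rintro ⟨x⟩; exact Quotient.sound (PreTerm.Rel.oplus_neg_zero x)
  oplus_neg_oplus := by
    rintro ⟨x⟩ ⟨y⟩; exact Quotient.sound (PreTerm.Rel.oplus_neg_oplus x y)

/-- The free generators. -/
def of {X : Type u} (x : X) : FreeMV X := Quotient.mk _ (PreTerm.var x)

/-- The homomorphism `FreeMV X → B` that extends `p : X → B`. -/
def lift {X : Type u} {B : Type v} [MVAlgebra B] (p : X → B) : MVHom (FreeMV X) B where
  toFun := Quotient.lift (PreTerm.eval p) (fun _ _ h => PreTerm.Rel.eval_eq p h)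
  map_oplus := by rintro ⟨x⟩ ⟨y⟩; rfl
  map_zero := rfl
  map_neg := by rintro ⟨x⟩; rfl

theorem lift_of {X : Type u} {B : Type v} [MVAlgebra B] (p : X → B) (x : X) :
    (lift p).toFun (of x) = p x := rfl

theorem hom_eq_lift {X : Type u} {B : Type v} [MVAlgebra B] (p : X → B)
    (g : MVHom (FreeMV X) B) (hg : ∀ x, g.toFun (of x) = p x) : g = lift p := by
  have key : g.toFun = (lift p).toFun := by
    funext t
    induction t using Quotient.inductionOn with
    | h t =>
      induction t with
      | var x => exact hg x
      | zero => exact g.map_zero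
      | neg s ih =>
        exact (g.map_neg (Quotient.mk _ s)).trans (congrArg MVAlgebra.neg ih)
      | oplus s t ih₁ ih₂ =>
        exact (g.map_oplus (Quotient.mk _ s) (Quotient.mk _ t)).trans
          (congrArg₂ MVAlgebra.oplus ih₁ ih₂)
  cases g
  simp only at key
  subst key
  rfl

theorem existsUnique_hom {X : Type u} {B : Type v} [MVAlgebra B] (p : X → B) :
    ∃! g : MVHom (FreeMV X) B, ∀ x, g.toFun (of x) = p x :=
  ⟨lift p, lift_of p, fun g hg => hom_eq_lift p g hg⟩

end FreeMV

/-- The standard MV-algebra `[0,1]`: `x ⊕ y = min (x + y) 1`, `¬x = 1 - x`, neutral element `0`. -/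
noncomputable instance : MVAlgebra unitInterval where
  oplus x y := ⟨min ((x : ℝ) + y) 1,
    le_min (add_nonneg x.2.1 y.2.1) zero_le_one, min_le_right _ _⟩
  zero := 0
  neg x := ⟨1 - (x : ℝ), sub_nonneg.2 x.2.2, sub_le_self _ x.2.1⟩
  oplus_assoc := by
    rintro ⟨x, hx⟩ ⟨y, hy⟩ ⟨z, hz⟩
    obtain ⟨hx0, hx1⟩ := hx
    obtain ⟨hy0, hy1⟩ := hy
    obtain ⟨hz0, hz1⟩ := hz
    apply Subtype.ext
    show min (min (x + y) 1 + z) 1 = min (x + min (y + z) 1) 1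
    grind
  oplus_comm x y := by
    apply Subtype.ext
    show min ((x : ℝ) + y) 1 = min ((y : ℝ) + x) 1
    rw [add_comm]
  oplus_zero x := by
    apply Subtype.ext
    show min ((x : ℝ) + 0) 1 = x
    rw [add_zero, min_eq_left x.2.2]
  neg_neg x := by
    apply Subtype.ext
    show 1 - (1 - (x : ℝ)) = x
    ring
  oplus_neg_zero x := by
    apply Subtype.ext
    show min ((x : ℝ) + (1 - 0)) 1 = 1 - 0
    rw [sub_zero, min_eq_right (by linarith [x.2.1])]
  oplus_neg_oplus := by
    rintro ⟨x, hx⟩ ⟨y, hy⟩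
    obtain ⟨hx0, hx1⟩ := hx
    obtain ⟨hy0, hy1⟩ := hy
    apply Subtype.ext
    show min (x + (1 - min (x + (1 - y)) 1)) 1 = min (y + (1 - min (y + (1 - x)) 1)) 1
    grind

/-- A map `f : [0,1]^ι → [0,1]` on a finite-dimensional cube is piecewise linear with integer
coefficients: it is continuous, and there are finitely many real-valued affine functions with
integer coefficients (slopes `a i`, constant term `b i`) such that at each point `f` agrees with
one of them. -/
def IsPiecewiseLinearIntFin {ι : Type u} [Fintype ι]
    (f : (ι → unitInterval) → unitInterval) : Prop :=
  Continuous f ∧ ∃ (k : ℕ) (a : Fin k → ι → ℤ) (b : Fin k → ℤ),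
    ∀ x : ι → unitInterval, ∃ i : Fin k,
      (f x : ℝ) = ∑ m, (a i m : ℝ) * (x m : ℝ) + (b i : ℝ)

/-- A map `f : [0,1]^I → [0,1]`, with `I` arbitrary, is piecewise linear with integer coefficients:
it is the composition of the projection to `[0,1]^I'` for a finite `I' ⊆ I` and of a
piecewise linear map with integer coefficients on `[0,1]^I'`. -/
def IsPiecewiseLinearInt {I : Type u} (f : (I → unitInterval) → unitInterval) : Prop :=
  ∃ (I' : Finset I) (g : (I' → unitInterval) → unitInterval),
    IsPiecewiseLinearIntFin g ∧ ∀ x : I → unitInterval, f x = g (I'.restrict x)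

/-- `η : P → Q` is definable: there are elements `t j` of the free MV-algebra over `I` such that
`η(p)(j)` is the value at `t j` of the unique homomorphism `FreeMV I → [0,1]` extending `p`. -/
def IsDefinableMap {I : Type u} {J : Type v} {P : Set (I → unitInterval)}
    {Q : Set (J → unitInterval)} (η : P → Q) : Prop :=
  ∃ t : J → FreeMV I, ∀ (p : P) (j : J),
    (η p : J → unitInterval) j = (FreeMV.lift (p : I → unitInterval)).toFun (t j)

/-- `η : P → Q` is a `ℤ`-map: each coordinate of `η` is the restriction to `P` of a piecewise
linear map with integer coefficients on the whole cube. -/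
def IsZMap {I : Type u} {J : Type v} {P : Set (I → unitInterval)}
    {Q : Set (J → unitInterval)} (η : P → Q) : Prop :=
  ∀ j : J, ∃ ξ : (I → unitInterval) → unitInterval, IsPiecewiseLinearInt ξ ∧
    ∀ p : P, (η p : J → unitInterval) j = ξ p

/-- Each finite projection `π_{J'} ∘ η` of `η : P → Q` factors as `ξ ∘ π_{I'}` with `I'` finite and
`ξ : [0,1]^I' → [0,1]^J'` a `ℤ`-map. -/
def FinitelyFactorsThroughZMaps {I : Type u} {J : Type v} {P : Set (I → unitInterval)}
    {Q : Set (J → unitInterval)} (η : P → Q) : Prop :=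
  ∀ J' : Finset J, ∃ (I' : Finset I)
    (ξ : ↥(Set.univ : Set (I' → unitInterval)) → ↥(Set.univ : Set (J' → unitInterval))),
    IsZMap ξ ∧ ∀ p : P, J'.restrict (η p : J → unitInterval) =
      (ξ ⟨I'.restrict (p : I → unitInterval), Set.mem_univ _⟩ : J' → unitInterval)

/-! ### Piecewise linear functions with integer coefficients -/

/-! A term involves finitely many variables, and `⊕`, `¬` preserve piecewise linearity, so definable
maps are ℤ-maps by induction on terms. The converse is McNaughton's theorem, applied to each
coordinate. Passing between ℤ-maps and finite factorizations only takes the union of finitely many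
finite supports, and singletons `J'`.

McNaughton's theorem rests on a two-point property: for all `x`, `y`, some affine piece of `f` is at
most `f` at `x` and at least `f` at `y` (`exists_affine_piece_le_le`, a one-variable argument on the
segment from `x` to `y`). Hence `f` is a finite maximum of minima of pieces (`exists_eq_sup'_inf'`).
The pieces may be truncated to `[0,1]`; truncated integer affine forms are term functions
(`HasTermTruncations.sum_int_mul`), and so are their lattice combinations. -/

theorem IsPiecewiseLinearIntFin.of_finite {ι : Type u} [Fintype ι]
    {f : (ι → unitInterval) → unitInterval} (hf : Continuous f) {κ : Type*} [Finite κ]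
    (a : κ → ι → ℤ) (b : κ → ℤ)
    (h : ∀ x : ι → unitInterval, ∃ i : κ, (f x : ℝ) = ∑ m, (a i m : ℝ) * (x m : ℝ) + (b i : ℝ)) :
    IsPiecewiseLinearIntFin f := by
  obtain ⟨n, ⟨e⟩⟩ := Finite.exists_equiv_fin κ
  refine ⟨hf, n, fun i => a (e.symm i), fun i => b (e.symm i), fun x => ?_⟩
  obtain ⟨i, hi⟩ := h x
  exact ⟨e i, by simpa using hi⟩

theorem IsPiecewiseLinearIntFin.comp_reindex {ι : Type u} {κ : Type v} [Fintype ι] [Fintype κ]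
    {f : (ι → unitInterval) → unitInterval} (hf : IsPiecewiseLinearIntFin f) (φ : ι → κ) :
    IsPiecewiseLinearIntFin fun x : κ → unitInterval => f (x ∘ φ) := by
  classical
  obtain ⟨hc, k, a, b, h⟩ := hf
  -- `φ` need not be injective: the slopes of identified variables add up.
  refine ⟨by fun_prop, k, fun i m => ∑ n with φ n = m, a i n, b, fun x => ?_⟩
  obtain ⟨i, hi⟩ := h (x ∘ φ)
  refine ⟨i, ?_⟩
  rw [hi, ← Finset.sum_fiberwise (s := Finset.univ) φ]
  congr 1
  refine Finset.sum_congr rfl fun m _ => ?_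
  push_cast
  rw [Finset.sum_mul]
  refine Finset.sum_congr rfl fun n hn => ?_
  rw [Function.comp_apply, (Finset.mem_filter.1 hn).2]

theorem IsPiecewiseLinearIntFin.neg {ι : Type u} [Fintype ι]
    {f : (ι → unitInterval) → unitInterval} (hf : IsPiecewiseLinearIntFin f) :
    IsPiecewiseLinearIntFin fun x => MVAlgebra.neg (f x) := by
  obtain ⟨hc, k, a, b, h⟩ := hf
  refine ⟨?_, k, fun i m => -a i m, fun i => 1 - b i, fun x => ?_⟩
  · exact Continuous.subtype_mk (by fun_prop) _
  · obtain ⟨i, hi⟩ := h x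
    refine ⟨i, ?_⟩
    change 1 - (f x : ℝ) = _
    rw [hi]
    push_cast
    simp only [neg_mul, Finset.sum_neg_distrib]
    ring

theorem IsPiecewiseLinearIntFin.oplus {ι : Type u} [Fintype ι]
    {f g : (ι → unitInterval) → unitInterval} (hf : IsPiecewiseLinearIntFin f)
    (hg : IsPiecewiseLinearIntFin g) :
    IsPiecewiseLinearIntFin fun x => MVAlgebra.oplus (f x) (g x) := by
  obtain ⟨hc, k, a, b, h⟩ := hf
  obtain ⟨hc', k', a', b', h'⟩ := hg
  -- `none` is the constant piece `1`, active where the sum is cut off.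
  refine .of_finite (κ := Option (Fin k × Fin k')) ?_
    (fun i => i.elim 0 fun i => a i.1 + a' i.2) (fun i => i.elim 1 fun i => b i.1 + b' i.2)
    fun x => ?_
  · exact Continuous.subtype_mk (by fun_prop) _
  · change ∃ i, min ((f x : ℝ) + g x) 1 = _
    rcases le_total ((f x : ℝ) + g x) 1 with hle | hle
    · obtain ⟨i, hi⟩ := h x
      obtain ⟨i', hi'⟩ := h' x
      refine ⟨some (i, i'), ?_⟩
      rw [min_eq_left hle, hi, hi']
      simp only [Option.elim, Pi.add_apply, Int.cast_add, add_mul, Finset.sum_add_distrib]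
      ring
    · exact ⟨none, by simp [min_eq_right hle]⟩

theorem IsPiecewiseLinearIntFin.isPiecewiseLinearInt {ι : Type u} [Fintype ι]
    {f : (ι → unitInterval) → unitInterval} (hf : IsPiecewiseLinearIntFin f) :
    IsPiecewiseLinearInt f :=
  ⟨Finset.univ, _, hf.comp_reindex fun i => (⟨i, Finset.mem_univ i⟩ : (Finset.univ : Finset ι)),
    fun _ => rfl⟩

theorem IsPiecewiseLinearInt.comp_reindex {I : Type u} {K : Type v}
    {f : (I → unitInterval) → unitInterval} (hf : IsPiecewiseLinearInt f) (φ : I → K) :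
    IsPiecewiseLinearInt fun x : K → unitInterval => f (x ∘ φ) := by
  classical
  obtain ⟨I', g, hg, h⟩ := hf
  refine ⟨I'.image φ, _, hg.comp_reindex fun i : I' =>
    (⟨φ i, Finset.mem_image_of_mem φ i.2⟩ : I'.image φ), fun x => h _⟩

theorem IsPiecewiseLinearInt.neg {I : Type u} {f : (I → unitInterval) → unitInterval}
    (hf : IsPiecewiseLinearInt f) : IsPiecewiseLinearInt fun x => MVAlgebra.neg (f x) := by
  obtain ⟨I', g, hg, h⟩ := hf
  exact ⟨I', _, hg.neg, fun x => congrArg MVAlgebra.neg (h x)⟩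

theorem IsPiecewiseLinearInt.oplus {I : Type u} {f g : (I → unitInterval) → unitInterval}
    (hf : IsPiecewiseLinearInt f) (hg : IsPiecewiseLinearInt g) :
    IsPiecewiseLinearInt fun x => MVAlgebra.oplus (f x) (g x) := by
  classical
  obtain ⟨I₁, f', hf', h₁⟩ := hf
  obtain ⟨I₂, g', hg', h₂⟩ := hg
  refine ⟨I₁ ∪ I₂, _,
    (hf'.comp_reindex fun i : I₁ =>
      (⟨i, Finset.mem_union_left _ i.2⟩ : (I₁ ∪ I₂ : Finset I))).oplus
    (hg'.comp_reindex fun i : I₂ =>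
      (⟨i, Finset.mem_union_right _ i.2⟩ : (I₁ ∪ I₂ : Finset I))), fun x => congrArg₂ MVAlgebra.oplus (h₁ x) (h₂ x)⟩

theorem isPiecewiseLinearInt_zero {I : Type u} :
    IsPiecewiseLinearInt fun _ : I → unitInterval => (MVAlgebra.zero : unitInterval) := by
  refine ⟨∅, fun _ => MVAlgebra.zero, ⟨continuous_const, 1, 0, 0, fun x => ⟨0, ?_⟩⟩, fun _ => rfl⟩
  change (0 : ℝ) = _
  simp

theorem isPiecewiseLinearInt_apply {I : Type u} (i : I) :
    IsPiecewiseLinearInt fun x : I → unitInterval => x i := by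
  have h : IsPiecewiseLinearIntFin fun x : Unit → unitInterval => x () :=
    ⟨by fun_prop, 1, 1, 0, fun x => ⟨0, by simp⟩⟩
  exact h.isPiecewiseLinearInt.comp_reindex fun _ => i

theorem isPiecewiseLinearInt_lift {I : Type u} (t : FreeMV I) :
    IsPiecewiseLinearInt fun p : I → unitInterval => (FreeMV.lift p).toFun t := by
  induction t using Quotient.inductionOn with
  | h t =>
    induction t with
    | var x => exact isPiecewiseLinearInt_apply x
    | zero => exact isPiecewiseLinearInt_zero
    | neg s ih => exact ih.neg
    | oplus s t ih₁ ih₂ => exact ih₁.oplus ih₂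

/-! ### Term functions -/

/-- A real-valued function on the cube `[0,1]^I` is a term function if it is the evaluation of an
element of the free MV-algebra over `I`. -/
def IsTermFunction {I : Type u} (g : (I → unitInterval) → ℝ) : Prop :=
  ∃ t : FreeMV I, ∀ p, g p = (FreeMV.lift p).toFun t

namespace IsTermFunction

variable {I : Type u} {g h : (I → unitInterval) → ℝ}

theorem nonneg (hg : IsTermFunction g) (p : I → unitInterval) : 0 ≤ g p := by
  obtain ⟨t, ht⟩ := hg
  rw [ht]
  exact ((FreeMV.lift p).toFun t).2.1

theorem le_one (hg : IsTermFunction g) (p : I → unitInterval) : g p ≤ 1 := by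
  obtain ⟨t, ht⟩ := hg
  rw [ht]
  exact ((FreeMV.lift p).toFun t).2.2

theorem apply (i : I) : IsTermFunction fun p : I → unitInterval => (p i : ℝ) :=
  ⟨FreeMV.of i, fun _ => rfl⟩

theorem zero : IsTermFunction fun _ : I → unitInterval => (0 : ℝ) :=
  ⟨MVAlgebra.zero, fun _ => rfl⟩

theorem one_sub (hg : IsTermFunction g) : IsTermFunction fun p => 1 - g p := by
  obtain ⟨t, ht⟩ := hg
  refine ⟨MVAlgebra.neg t, fun p => ?_⟩
  beta_reduce
  rw [(FreeMV.lift p).map_neg, ht]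
  rfl

theorem add_min_one (hg : IsTermFunction g) (hh : IsTermFunction h) :
    IsTermFunction fun p => min (g p + h p) 1 := by
  obtain ⟨t, ht⟩ := hg
  obtain ⟨s, hs⟩ := hh
  refine ⟨MVAlgebra.oplus t s, fun p => ?_⟩
  beta_reduce
  rw [(FreeMV.lift p).map_oplus, ht, hs]
  rfl

theorem one : IsTermFunction fun _ : I → unitInterval => (1 : ℝ) := by
  simpa using (zero (I := I)).one_sub

theorem add_sub_one_max_zero (hg : IsTermFunction g) (hh : IsTermFunction h) :
    IsTermFunction fun p => max (g p + h p - 1) 0 := by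
  convert (hg.one_sub.add_min_one hh.one_sub).one_sub using 2 with p
  grind

/-- `g ⊕ ¬(g ⊕ ¬h)` evaluates to `g + max (h - g) 0`. -/
theorem max (hg : IsTermFunction g) (hh : IsTermFunction h) :
    IsTermFunction fun p => max (g p) (h p) := by
  convert hg.add_min_one (hg.add_min_one hh.one_sub).one_sub using 2 with p
  have := hg.le_one p
  have := hh.le_one p
  grind

theorem min (hg : IsTermFunction g) (hh : IsTermFunction h) :
    IsTermFunction fun p => min (g p) (h p) := by
  convert (hg.one_sub.max hh.one_sub).one_sub using 2 with p
  grind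

theorem finset_sup' {α : Type*} {s : Finset α} (hs : s.Nonempty)
    {f : α → (I → unitInterval) → ℝ} (hf : ∀ a ∈ s, IsTermFunction (f a)) :
    IsTermFunction fun p => s.sup' hs fun a => f a p := by
  induction hs using Finset.Nonempty.cons_induction with
  | singleton a => simpa using hf a (by simp)
  | cons a s ha hs ih =>
    simp only [Finset.sup'_cons hs]
    exact (hf a (by simp)).max (ih fun b hb => hf b (by simp [hb]))

theorem finset_inf' {α : Type*} {s : Finset α} (hs : s.Nonempty)
    {f : α → (I → unitInterval) → ℝ} (hf : ∀ a ∈ s, IsTermFunction (f a)) :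
    IsTermFunction fun p => s.inf' hs fun a => f a p := by
  induction hs using Finset.Nonempty.cons_induction with
  | singleton a => simpa using hf a (by simp)
  | cons a s ha hs ih =>
    simp only [Finset.inf'_cons hs]
    exact (hf a (by simp)).min (ih fun b hb => hf b (by simp [hb]))

end IsTermFunction

/-! ### Truncated integer affine forms -/

/-- All integer translates of `g`, truncated to `[0,1]`, are term functions. -/
def HasTermTruncations {I : Type u} (g : (I → unitInterval) → ℝ) : Prop :=
  ∀ b : ℤ, IsTermFunction fun p => max 0 (min 1 (g p + b))

namespace HasTermTruncations

variable {I : Type u} {g h : (I → unitInterval) → ℝ}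

theorem zero : HasTermTruncations fun _ : I → unitInterval => (0 : ℝ) := by
  intro b
  rcases le_or_gt b 0 with hb | hb
  · convert IsTermFunction.zero (I := I) using 2
    have : (b : ℝ) ≤ 0 := by exact_mod_cast hb
    grind
  · convert IsTermFunction.one (I := I) using 2
    have : (1 : ℝ) ≤ b := by exact_mod_cast hb
    grind

theorem add_int (hg : HasTermTruncations g) (n : ℤ) : HasTermTruncations fun p => g p + n := by
  intro b
  simpa [add_assoc] using hg (n + b)

/-- Write `τ` for truncation to `[0,1]` and `u = g + b`. As `0 ≤ h ≤ 1`, `τ(u + h) = max (min (τ u +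
h) 1 + τ(u + 1) - 1) 0`: for `u ≥ 0` the second truncation is `1`, for `u ≤ 0` the first is `0`. The
use of both `b` and `b + 1` is why all translates are carried along. -/
theorem add (hg : HasTermTruncations g) (hh : IsTermFunction h) :
    HasTermTruncations fun p => g p + h p := by
  intro b
  convert ((hg b).add_min_one hh).add_sub_one_max_zero (hg (b + 1)) using 2 with p
  have := hh.nonneg p
  have := hh.le_one p
  push_cast
  grind

theorem sub (hg : HasTermTruncations g) (hh : IsTermFunction h) :
    HasTermTruncations fun p => g p - h p := by
  convert (hg.add hh.one_sub).add_int (-1) using 2 with p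
  push_cast
  ring

theorem add_int_mul (hg : HasTermTruncations g) (hh : IsTermFunction h) (n : ℤ) :
    HasTermTruncations fun p => g p + n * h p := by
  induction n with
  | zero => simpa using hg
  | succ n ih =>
    convert ih.add hh using 2 with p
    push_cast
    ring
  | pred n ih =>
    convert ih.sub hh using 2 with p
    push_cast
    ring

theorem sum_int_mul {α : Type*} (s : Finset α) (a : α → ℤ) {f : α → (I → unitInterval) → ℝ}
    (hf : ∀ m, IsTermFunction (f m)) : HasTermTruncations fun p => ∑ m ∈ s, (a m : ℝ) * f m p := by
  classical
  induction s using Finset.induction_on with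
  | empty => simpa using zero
  | insert m s hm ih =>
    convert ih.add_int_mul (hf m) (a m) using 2 with p
    rw [Finset.sum_insert hm, add_comm]

end HasTermTruncations

/-! ### Lattice representation of piecewise affine functions -/

/-- Near each point `s`, a continuous piecewise affine function agrees at each `t` with a piece
that is active at `s` too. -/
theorem eventually_exists_common_piece {κ : Type*} [Finite κ] {S : Set ℝ} {h : ℝ → ℝ}
    (hc : ContinuousOn h S) (α β : κ → ℝ) (hp : ∀ t ∈ S, ∃ i, h t = α i + t * β i)
    {s : ℝ} (hs : s ∈ S) :
    ∀ᶠ t in nhdsWithin s S, ∃ i, h s = α i + s * β i ∧ h t = α i + t * β i := by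
  -- By continuity, a piece that differs from `h` at `s` differs from it nearby; finitely many
  -- pieces allow one common neighbourhood.
  have key : ∀ i, ∀ᶠ t in nhdsWithin s S, h t = α i + t * β i → h s = α i + s * β i := by
    intro i
    by_cases hi : h s = α i + s * β i
    · simp [hi]
    · have hcont : ContinuousWithinAt (fun t => α i + t * β i) S s := by fun_prop
      filter_upwards [((hc s hs).prodMk hcont).eventually
        (isOpen_ne_fun continuous_fst continuous_snd |>.mem_nhds hi)] with t ht heq
      exact absurd heq ht
  filter_upwards [Filter.eventually_all.2 key, self_mem_nhdsWithin] with t ht htS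
  obtain ⟨i, hi⟩ := hp t htS
  exact ⟨i, ht i hi, hi⟩

theorem exists_piece_le_zero_le {κ : Type*} [Finite κ] {h : ℝ → ℝ}
    (hc : ContinuousOn h (Set.Icc 0 1)) (α β : κ → ℝ)
    (hp : ∀ t ∈ Set.Icc (0 : ℝ) 1, ∃ i, h t = α i + t * β i) (h0 : h 0 = 0) (h1 : h 1 = 0) :
    ∃ i, α i ≤ 0 ∧ 0 ≤ α i + β i := by
  have near : ∀ s ∈ Set.Icc (0 : ℝ) 1, ∃ ε > 0, ∀ t ∈ Set.Icc (0 : ℝ) 1, |t - s| < ε →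
      ∃ i, h s = α i + s * β i ∧ h t = α i + t * β i := by
    intro s hs
    obtain ⟨ε, hε, H⟩ := Metric.mem_nhdsWithin_iff.1 (eventually_exists_common_piece hc α β hp hs)
    exact ⟨ε, hε, fun t ht hts => H ⟨by simpa [Real.dist_eq] using hts, ht⟩⟩
  obtain ⟨ε, hε, near1⟩ := near 1 (by simp)
  -- If `h t ≤ 0` for some `t < 1` close to `1`, a piece shared by `t` and `1` vanishes at `1` and
  -- has nonnegative slope. Otherwise `h > 0` just before `1`; a piece shared by the last point `s`
  -- with `h s ≤ 0` before `1` and a slightly later point has positive slope.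
  by_cases hex : ∃ t ∈ Set.Ico (0 : ℝ) 1, 1 - ε < t ∧ h t ≤ 0
  · obtain ⟨t, ht, htε, hle⟩ := hex
    obtain ⟨i, hi1, hit⟩ := near1 t ⟨ht.1, ht.2.le⟩ (by rw [abs_lt]; grind)
    refine ⟨i, ?_, by linarith⟩
    by_contra! hα
    nlinarith [mul_pos hα (sub_pos.2 ht.2)]
  · push Not at hex
    -- Cutting at `c < 1` keeps the endpoint `1`, where `h` vanishes, out of the compact set.
    obtain ⟨c, hc0, hc1, hcε⟩ : ∃ c : ℝ, 0 ≤ c ∧ c < 1 ∧ 1 - ε ≤ c :=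
      ⟨max 0 (1 - ε), by grind⟩
    have hK : IsCompact {t ∈ Set.Icc 0 c | h t ≤ 0} :=
      isCompact_Icc.of_isClosed_subset
        ((hc.mono (Set.Icc_subset_Icc_right hc1.le)).preimage_isClosed_of_isClosed isClosed_Icc
          isClosed_Iic) fun t ht => ht.1
    obtain ⟨s, ⟨hs, hs0⟩, hmax⟩ := hK.exists_isGreatest ⟨0, ⟨le_rfl, hc0⟩, h0.le⟩
    have hpos : ∀ t, s < t → t < 1 → 0 < h t := by
      intro t hst ht1
      by_contra! hle
      by_cases htc : t ≤ c
      · exact absurd (hmax ⟨⟨hs.1.trans hst.le, htc⟩, hle⟩) (not_le.2 hst)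
      · exact absurd (hex t ⟨hs.1.trans hst.le, ht1⟩ (by linarith)) (not_lt.2 hle)
    obtain ⟨δ, hδ, nears⟩ := near s ⟨hs.1, hs.2.trans hc1.le⟩
    obtain ⟨t, hst, htlt⟩ := exists_between (lt_min (hs.2.trans_lt hc1) (lt_add_of_pos_right s hδ))
    have ht1 := htlt.trans_le (min_le_left _ _)
    have htδ := htlt.trans_le (min_le_right _ _)
    obtain ⟨i, his, hit⟩ := nears t ⟨hs.1.trans hst.le, ht1.le⟩ (by rw [abs_lt]; grind)
    have hht := hpos t hst ht1
    have hβ : 0 < β i := by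
      by_contra! hβ
      nlinarith
    exact ⟨i, by nlinarith [hs.1], by nlinarith⟩

/-- Subtracting the chord of `h` reduces this to zero boundary values. -/
theorem exists_piece_le_le {κ : Type*} [Finite κ] {h : ℝ → ℝ}
    (hc : ContinuousOn h (Set.Icc 0 1)) (α β : κ → ℝ)
    (hp : ∀ t ∈ Set.Icc (0 : ℝ) 1, ∃ i, h t = α i + t * β i) :
    ∃ i, α i ≤ h 0 ∧ h 1 ≤ α i + β i := by
  obtain ⟨i, hi0, hi1⟩ := exists_piece_le_zero_le (h := fun t => h t - (h 0 + t * (h 1 - h 0)))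
    (by fun_prop) (fun i => α i - h 0) (fun i => β i - (h 1 - h 0))
    (fun t ht => (hp t ht).imp fun i hi => by rw [hi]; ring) (by ring) (by ring)
  exact ⟨i, by linarith, by linarith⟩

/-- Given two points of the cube, a continuous piecewise affine function has a piece that lies below
it at the first point and above it at the second one. -/
theorem exists_affine_piece_le_le {ι : Type u} [Fintype ι] {κ : Type*} [Finite κ]
    {f : (ι → unitInterval) → unitInterval} (hf : Continuous f) (a : κ → ι → ℤ) (b : κ → ℤ)
    (h : ∀ x : ι → unitInterval, ∃ i : κ, (f x : ℝ) = ∑ m, (a i m : ℝ) * (x m : ℝ) + (b i : ℝ))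
    (x y : ι → unitInterval) :
    ∃ i, ∑ m, (a i m : ℝ) * (x m : ℝ) + (b i : ℝ) ≤ f x ∧
      f y ≤ ∑ m, (a i m : ℝ) * (y m : ℝ) + (b i : ℝ) := by
  -- The segment from `x` to `y`; the projection only matters for `t` outside `[0,1]`.
  let z : ℝ → ι → unitInterval := fun t m =>
    Set.projIcc 0 1 zero_le_one ((x m : ℝ) + t * ((y m : ℝ) - x m))
  have hz : ∀ t ∈ Set.Icc (0 : ℝ) 1, ∀ m, (z t m : ℝ) = (x m : ℝ) + t * ((y m : ℝ) - x m) := by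
    intro t ht m
    have hx := (x m).2
    have hy := (y m).2
    have hmem : (x m : ℝ) + t * ((y m : ℝ) - x m) ∈ Set.Icc (0 : ℝ) 1 := by
      constructor
      · nlinarith [mul_nonneg (sub_nonneg.2 ht.2) hx.1, mul_nonneg ht.1 hy.1]
      · nlinarith [mul_nonneg (sub_nonneg.2 ht.2) (sub_nonneg.2 hx.2),
          mul_nonneg ht.1 (sub_nonneg.2 hy.2)]
    exact congrArg Subtype.val (Set.projIcc_of_mem zero_le_one hmem)
  have hz0 : z 0 = x := by
    funext m
    exact Subtype.ext (by rw [hz 0 (by simp)]; ring)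
  have hz1 : z 1 = y := by
    funext m
    exact Subtype.ext (by rw [hz 1 (by simp)]; ring)
  have hzc : Continuous z :=
    continuous_pi fun m => continuous_projIcc.comp (by fun_prop)
  obtain ⟨i, hi0, hi1⟩ := exists_piece_le_le (h := fun t => (f (z t) : ℝ))
    (continuous_subtype_val.comp (hf.comp hzc)).continuousOn
    (fun i => ∑ m, (a i m : ℝ) * (x m : ℝ) + (b i : ℝ))
    (fun i => ∑ m, (a i m : ℝ) * ((y m : ℝ) - x m)) fun t ht => by
      obtain ⟨i, hi⟩ := h (z t)
      refine ⟨i, ?_⟩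
      simp only [hi, hz t ht, mul_add, Finset.sum_add_distrib, Finset.mul_sum, mul_left_comm t]
      ring
  rw [hz0] at hi0
  refine ⟨i, hi0, ?_⟩
  rw [hz1] at hi1
  refine hi1.trans_eq ?_
  simp only [mul_sub, Finset.sum_sub_distrib]
  ring

/-- If for any two points there is an `F i` that lies below `f` at the first point and above `f` at
the second one, then `f` is a maximum of minima of the `F i`. -/
theorem exists_eq_sup'_inf' {X κ R : Type*} [LinearOrder R] [Fintype κ] [Nonempty X]
    (f : X → R) (F : κ → X → R) (h : ∀ x y, ∃ i, F i x ≤ f x ∧ f y ≤ F i y) :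
    ∃ (T : Finset {s : Finset κ // s.Nonempty}) (hT : T.Nonempty),
      ∀ x, f x = T.sup' hT fun s => s.1.inf' s.2 fun i => F i x := by
  classical
  -- The minimum over `S y` is at least `f` at `y`, and at most `f` everywhere by the two-point
  -- property. `S` takes finitely many values even if `X` is infinite.
  let S : X → {s : Finset κ // s.Nonempty} := fun y =>
    ⟨Finset.univ.filter fun i => f y ≤ F i y, (h y y).imp fun i hi => by simp [hi.2]⟩
  have hfin : (Set.range S).Finite := Set.toFinite _
  refine ⟨hfin.toFinset, by simpa using Set.range_nonempty S, fun x => le_antisymm ?_ ?_⟩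
  · refine le_trans ?_ (Finset.le_sup' _ (hfin.mem_toFinset.2 ⟨x, rfl⟩))
    exact Finset.le_inf' _ _ fun i hi => (Finset.mem_filter.1 hi).2
  · refine Finset.sup'_le _ _ fun s hs => ?_
    obtain ⟨y, rfl⟩ := hfin.mem_toFinset.1 hs
    obtain ⟨i, hix, hiy⟩ := h x y
    exact (Finset.inf'_le _ (by simpa [S] using hiy)).trans hix

/-- **McNaughton's theorem**: piecewise linear functions with integer coefficients are term
functions. -/
theorem IsPiecewiseLinearInt.isTermFunction {I : Type u} {f : (I → unitInterval) → unitInterval}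
    (hf : IsPiecewiseLinearInt f) : IsTermFunction fun p => (f p : ℝ) := by
  obtain ⟨I', g, ⟨hc, k, a, b, h⟩, hfg⟩ := hf
  -- Truncating the pieces keeps the two-point property because `g` has values in `[0,1]`.
  obtain ⟨T, hT, hsup⟩ := exists_eq_sup'_inf' (fun x => (g x : ℝ))
    (fun i x => max 0 (min 1 (∑ m, (a i m : ℝ) * (x m : ℝ) + (b i : ℝ)))) fun x y => by
      obtain ⟨i, hx, hy⟩ := exists_affine_piece_le_le hc a b h x y
      exact ⟨i, max_le (g x).2.1 ((min_le_right _ _).trans hx),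
        le_max_of_le_right (le_min (g y).2.2 hy)⟩
  have key : ∀ i, IsTermFunction fun p : I → unitInterval =>
      max 0 (min 1 (∑ m : I', (a i m : ℝ) * (p m : ℝ) + (b i : ℝ))) := fun i =>
    HasTermTruncations.sum_int_mul Finset.univ (a i)
      (fun m : I' => IsTermFunction.apply (m : I)) (b i)
  convert IsTermFunction.finset_sup' hT fun s _ =>
    IsTermFunction.finset_inf' s.2 fun i _ => key i using 2 with p
  rw [hfg]
  exact hsup _

theorem mainTheorem2 {I : Type u} {J : Type v} (P : Set (I → unitInterval))
    (Q : Set (J → unitInterval)) (η : P → Q) :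
    List.TFAE [IsDefinableMap η, IsZMap η, FinitelyFactorsThroughZMaps η] := by
  classical
  tfae_have 1 → 2 := by
    rintro ⟨t, ht⟩ j
    exact ⟨_, isPiecewiseLinearInt_lift (t j), fun p => ht p j⟩
  tfae_have 2 → 1 := by
    intro hη
    choose ξ hξ h using hη
    choose t ht using fun j => (hξ j).isTermFunction
    exact ⟨t, fun p j => (h j p).trans (Subtype.ext (ht j p))⟩
  tfae_have 2 → 3 := by
    intro hη J'
    choose ξ hξ h using hη
    choose K g hg hξg using hξ
    have hK : ∀ j : J', ∀ i ∈ K j, i ∈ J'.biUnion K := fun j i hi =>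
      Finset.mem_biUnion.2 ⟨j, j.2, hi⟩
    refine ⟨J'.biUnion K,
      fun x => ⟨fun j => g j fun i => x.1 ⟨i, hK j i i.2⟩, Set.mem_univ _⟩, fun j => ?_, fun p => ?_⟩
    · exact ⟨_, ((hg j).comp_reindex fun i : K j =>
        (⟨i, hK j i i.2⟩ : J'.biUnion K)).isPiecewiseLinearInt, fun _ => rfl⟩
    · funext j
      exact (h j p).trans (hξg j p)
  tfae_have 3 → 2 := by
    intro hη j
    obtain ⟨I', ξ, hξ, h⟩ := hη {j}
    obtain ⟨g, hg, hξg⟩ := hξ ⟨j, Finset.mem_singleton_self j⟩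
    refine ⟨_, hg.comp_reindex (Subtype.val : I' → I), fun p => ?_⟩
    exact (congrFun (h p) ⟨j, Finset.mem_singleton_self j⟩).trans (hξg _)
  tfae_finish
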